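/- Let $H$ be the honeycomb lattice in $\mathbb R^2$ with bonds of length $1$ and set of sites $\mathbb H$, placed so that the origin is a site and the segment from $(0,0)$ to $(1,0)$ is a bond. A configuration is a function $C:\mathbb H\to\{-1,1\}$; the scatterer at $\mathbf h$ is a right scatterer if $C(\mathbf h)=1$ and a left scatterer if $C(\mathbf h)=-1$. Given an initial configuration $C=C(0)$, the flipping rotator model started from $\mathbf r(0)=(0,0)$ and $\mathbf v(0)=(1,0)$ is the deterministic motion defined for $t=0,1,2,\dots$ by \[ \mathbf r(t+1)=\mathbf r(t)+\mathbf v(t),\qquad \mathbf v(t+1)=R\big[C(t,\mathbf r(t+1))\big]\mathbf v(t), \] \[ C(t+1,\mathbf h)=\begin{cases}-C(t,\mathbf h)&\text{if }\mathbf h=\mathbf r(t+1),\\ \phantom{-}C(t,\mathbf h)&\text{otherwise,}\end{cases} \qquad R[z]=\begin{pmatrix}\cos(\frac{\pi}{3}z)&\sin(\frac{\pi}{3}z)\\-\sin(\frac{\pi}{3}z)&\cos(\frac{\pi}{3}z)\end{pmatrix}. \] The trajectory is called periodic if there is an integer $t_p\ge 1$ such that $\mathbf r(t)=\mathbf r(t+t_p)$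 for all $t\ge 0$. Let $F=\{f_1,\dots,f_n\}$ be a finite family of functions $f_i:[0,1]\to[0,1]$ and let $p\in[0,1]$. In the model $(H;F(p))$ the initial configuration $C$ is random: the initial orientations $C(\mathbf h)$, $\mathbf h\in\mathbb H$, are independent random variables, and for each site $\mathbf h$ there is an $i$ (which may depend on $\mathbf h$) such that $\mathbb P[C(\mathbf h)=1]=f_i(p)$. If $f_i(p)\ne 0$ and $f_i(p)\neq 1$ for every $i$, then, with probability $1$, the trajectory of the particle in the model $(H;F(p))$ is periodic. -/

import Mathlib

open MeasureTheory ProbabilityTheory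
open scoped Matrix

noncomputable section

namespace FlippingRotator

/-- The Euclidean plane, in Cartesian coordinates. -/
abbrev Plane : Type := Fin 2 → ℝ

/-- The point `a • (1, 0) + b • (1/2, √3/2)` of the triangular lattice with unit side. -/
def latticePoint (a b : ℤ) : Plane := ![(a : ℝ) + (b : ℝ) / 2, (b : ℝ) * (√3 / 2)]

/-- The sites of the honeycomb lattice with unit bonds that has the origin as a site and a horizontal
bond from the origin to `(1, 0)`: the triangular lattice without the centres of the hexagons, which
are the points with `a - b` congruent to `2` modulo `3` (for example `(-1, 0)`). Two sites are joined
by a bond when their distance is `1`. -/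
def honeycomb : Set Plane := {x | ∃ a b : ℤ, (a - b) % 3 ≠ 2 ∧ x = latticePoint a b}

/-- The orientation of a scatterer: `1` is a right scatterer, `-1` a left scatterer. -/
abbrev Orientation : Type := ℤˣ

/-- A configuration of scatterers: an orientation at every site. -/
abbrev Config : Type := honeycomb → Orientation

/-- The orientation of the scatterer at `x`. The value off the honeycomb lattice is a convention that
is never used, since the particle stays on the lattice (`position_mem_honeycomb` below). -/
def Config.orientationAt (C : Config) (x : Plane) : Orientation :=
  open Classical in if hx : x ∈ honeycomb then C ⟨x, hx⟩ else 1

/-- The configuration after the scatterer at `x` has been flipped. -/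
def Config.flip (C : Config) (x : Plane) : Config :=
  open Classical in fun h => if (h : Plane) = x then -C h else C h

/-- The matrix `R[z]` of the rotation by the angle `π / 3` to the right for `z = 1`, and to the left
for `z = -1`. -/
def rotation (z : Orientation) : Matrix (Fin 2) (Fin 2) ℝ :=
  !![Real.cos (Real.pi / 3 * ((z : ℤ) : ℝ)), Real.sin (Real.pi / 3 * ((z : ℤ) : ℝ));
    -Real.sin (Real.pi / 3 * ((z : ℤ) : ℝ)), Real.cos (Real.pi / 3 * ((z : ℤ) : ℝ))]

/-- The state at an integer time: the position, the velocity immediately after scattering, and the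
configuration of all scatterers. -/
structure State where
  pos : Plane
  vel : Plane
  config : Config

/-- One time step: the particle moves along its velocity to the next site, its velocity is rotated by
the scatterer there, and this scatterer is flipped. -/
def State.next (s : State) : State where
  pos := s.pos + s.vel
  vel := rotation (s.config.orientationAt (s.pos + s.vel)) *ᵥ s.vel
  config := s.config.flip (s.pos + s.vel)

/-- The state at time `t` of the flipping rotator model in which the particle starts at the origin
with velocity `(1, 0)` in the initial configuration `C`. -/
def stateAt (C : Config) (t : ℕ) : State := State.next^[t] ⟨0, ![1, 0], C⟩

/-- The trajectory of the particle: its position at the times `0, 1, 2, …`. -/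
def position (C : Config) (t : ℕ) : Plane := (stateAt C t).pos

/-- The trajectory is periodic from time `0` on, with some period `T ≥ 1`. -/
def HasPeriodicTrajectory (C : Config) : Prop :=
  ∃ T : ℕ, 0 < T ∧ ∀ t : ℕ, position C t = position C (t + T)

/-- The random initial configurations of the model `(H; F(p))` with `F = {f₁, …, fₙ}`: the initial
orientations are independent random variables, and each site is a right scatterer with probability
`fᵢ(p)` for some `i`, which may depend on the site. -/
structure IsInitialConfiguration {Ω : Type*} [MeasurableSpace Ω] (P : Measure Ω) {n : ℕ}
    (f : Fin n → Set.Icc (0 : ℝ) 1 → Set.Icc (0 : ℝ) 1) (p : Set.Icc (0 : ℝ) 1)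
    (C : honeycomb → Ω → Orientation) : Prop where
  measurable : ∀ h, Measurable (C h)
  indep : iIndepFun C P
  prob_right : ∀ h, ∃ i, P.real {ω | C h ω = 1} = (f i p : ℝ)

theorem latticePoint_add (a b c d : ℤ) :
    latticePoint a b + latticePoint c d = latticePoint (a + c) (b + d) := by
  ext i
  fin_cases i <;> simp [latticePoint] <;> ring

theorem rotation_mulVec_latticePoint (z : Orientation) (c d : ℤ) :
    rotation z *ᵥ latticePoint c d =
      if z = 1 then latticePoint (c + d) (-c) else latticePoint (-d) (c + d) := by
  have h3 : √3 * √3 = (3 : ℝ) := Real.mul_self_sqrt (by norm_num)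
  rcases Int.units_eq_one_or z with rfl | rfl
  · ext i
    fin_cases i <;> simp [rotation, latticePoint, Matrix.mulVec, dotProduct]
    · linear_combination (d : ℝ) / 4 * h3
    · ring
  · ext i
    fin_cases i <;> simp [rotation, latticePoint, Matrix.mulVec, dotProduct]
    · linear_combination -(d : ℝ) / 4 * h3
    · ring

/-- The particle never leaves the honeycomb lattice. -/
theorem position_mem_honeycomb (C : Config) (t : ℕ) : position C t ∈ honeycomb := by
  have key : ∀ t, ∃ a b c d : ℤ, (stateAt C t).pos = latticePoint a b ∧
      (stateAt C t).vel = latticePoint c d ∧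
      ((a - b) % 3 = 0 ∧ (c - d) % 3 = 1 ∨ (a - b) % 3 = 1 ∧ (c - d) % 3 = 2) := by
    intro t
    induction t with
    | zero =>
      refine ⟨0, 0, 1, 0, ?_, ?_, by simp⟩ <;> ext i <;> fin_cases i <;>
        simp [stateAt, latticePoint]
    | succ t ih =>
      obtain ⟨a, b, c, d, hp, hv, h⟩ := ih
      have hs : stateAt C (t + 1) = (stateAt C t).next := Function.iterate_succ_apply' _ _ _
      rw [hs]
      simp only [State.next, hp, hv, latticePoint_add, rotation_mulVec_latticePoint]
      split_ifs
      · exact ⟨_, _, _, _, rfl, rfl, by omega⟩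
      · exact ⟨_, _, _, _, rfl, rfl, by omega⟩
  obtain ⟨a, b, c, d, hp, -, h⟩ := key t
  exact ⟨a, b, by omega, hp⟩

end FlippingRotator

end

/-! The dynamics is reversible: a site just passed holds the flipped scatterer, which undoes the
turn when the path is run backwards. Hence a trajectory confined to a finite set returns to its
initial state by pigeonhole and injectivity of `step` (`LState.OnBond.exists_period`).

Otherwise the forward and the backward trajectory of the initial state both leave a triangle `tri
N`. A mirror is a finite pattern outside the triangle that sends the particle back along its exit
bond, at the cost of a change `F` of the pattern. The reflected particle retraces its path, leaves
at the other end, is reflected there and comes back; on the second visit it runs each mirror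
backwards and restores it. So the initial state recurs (`exists_period_of_reflects`, or
`exists_period_of_reflects_same` when both ends use one bond).

Four explicit mirrors, rotated by multiples of 120 degrees, extend to the left or to the right of
any exit, which makes the mirrors of two distinct exits disjoint (`exists_disjoint_sidePattern`).
Thus, whatever the configuration in `tri N`, at most 40 orientations in `tri (N + 20)` outside `tri
N` force periodicity (`exists_pattern`). Successive annuli give trials, each with conditional
success probability at least `ε ^ 40`, so almost surely one succeeds
(`ae_of_forall_exists_pattern`). -/

namespace FlippingRotator

/-! ### Lattice dynamics, time reversal and changes of configuration -/

/-- The velocity `v`, in triangular coordinates, after scattering with orientation `z`. -/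
def turn (z : ℤˣ) (v : ℤ × ℤ) : ℤ × ℤ :=
  if z = 1 then (v.1 + v.2, -v.1) else (-v.2, v.1 + v.2)

/-- A state of the flipping rotator in the triangular coordinates of `latticePoint`. -/
@[ext]
structure LState where
  pos : ℤ × ℤ
  vel : ℤ × ℤ
  cfg : ℤ × ℤ → ℤˣ

namespace LState

/-- One time step in triangular coordinates. -/
def step (s : LState) : LState where
  pos := s.pos + s.vel
  vel := turn (s.cfg (s.pos + s.vel)) s.vel
  cfg := Function.update s.cfg (s.pos + s.vel) (-s.cfg (s.pos + s.vel))

/-- Time reversal: the current bond is traversed in the opposite direction. -/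
def rev (s : LState) : LState := ⟨s.pos + s.vel, -s.vel, s.cfg⟩

/-- The state with the orientations multiplied by `G`. -/
def twist (G : ℤ × ℤ → ℤˣ) (s : LState) : LState := ⟨s.pos, s.vel, s.cfg * G⟩

theorem rev_rev (s : LState) : s.rev.rev = s := by
  ext <;> simp [rev]

theorem rev_twist (G : ℤ × ℤ → ℤˣ) (s : LState) : (s.twist G).rev = s.rev.twist G := rfl

theorem twist_twist (G G' : ℤ × ℤ → ℤˣ) (s : LState) :
    (s.twist G).twist G' = (s.twist G').twist G := by
  ext <;> simp [twist, mul_right_comm]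

theorem turn_neg_turn (z : ℤˣ) (v : ℤ × ℤ) : turn (-z) (-turn z v) = -v := by
  rcases Int.units_eq_one_or z with rfl | rfl <;> ext <;> simp [turn]

/-- The reversed particle meets the scatterer it has just flipped, so it turns the opposite way and
flips the scatterer back. -/
theorem step_rev_step (s : LState) : s.step.rev.step = s.rev := by
  have h : (s.pos + s.vel + turn (s.cfg (s.pos + s.vel)) s.vel +
      -turn (s.cfg (s.pos + s.vel)) s.vel) = s.pos + s.vel := by abel
  simp [step, rev, turn_neg_turn]

theorem iterate_step_rev (k : ℕ) (s : LState) : step^[k] (step^[k] s).rev = s.rev := by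
  induction k generalizing s with
  | zero => rfl
  | succ k ih =>
    rw [Function.iterate_succ_apply' step k, Function.iterate_succ_apply step k s, ih,
      step_rev_step]

theorem step_injective : Function.Injective step := fun s s' h => by
  have := step_rev_step s
  rw [h, step_rev_step] at this
  rw [← rev_rev s, ← this, rev_rev]

/-- Only the scatterer at the site being entered is read or flipped, so changes elsewhere are
carried along passively. -/
theorem step_twist {G : ℤ × ℤ → ℤˣ} {s : LState} (h : G s.step.pos = 1) :
    (s.twist G).step = s.step.twist G := by
  have h : G (s.pos + s.vel) = 1 := h
  ext z
  · rfl
  · rfl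
  · simp [step, twist, h]
  · simp [step, twist, h]
  · by_cases hz : z = s.pos + s.vel
    · subst hz; simp [step, twist, h]
    · simp [step, twist, hz]

theorem iterate_step_twist {G : ℤ × ℤ → ℤˣ} {s : LState} {k : ℕ}
    (h : ∀ j < k, G (step^[j + 1] s).pos = 1) :
    step^[k] (s.twist G) = (step^[k] s).twist G := by
  induction k with
  | zero => rfl
  | succ k ih =>
    have h1 := h k (by omega)
    rw [Function.iterate_succ_apply'] at h1
    rw [Function.iterate_succ_apply', ih fun j hj => h j (by omega), step_twist h1,
      Function.iterate_succ_apply']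

theorem cfg_iterate_step {s : LState} {k : ℕ} {z : ℤ × ℤ}
    (h : ∀ j < k, (step^[j + 1] s).pos ≠ z) : (step^[k] s).cfg z = s.cfg z := by
  induction k with
  | zero => rfl
  | succ k ih =>
    have h1 := h k (by omega)
    rw [Function.iterate_succ_apply'] at h1 ⊢
    rw [← ih fun j hj => h j (by omega)]
    exact Function.update_of_ne (Ne.symm h1) _ _

end LState

open LState

/-! ### Reflecting patterns, their symmetries and their verification -/

/-- A particle on the bond from `x` in direction `v` is sent back along this bond, at the cost of
flipping scatterers in `D`, when the orientations on `D` are given by `o`. -/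
def Reflects (x v : ℤ × ℤ) (D : Finset (ℤ × ℤ)) (o : ℤ × ℤ → ℤˣ) : Prop :=
  ∃ (K : ℕ) (F : ℤ × ℤ → ℤˣ), (∀ z ∉ D, F z = 1) ∧
    ∀ c : ℤ × ℤ → ℤˣ, (∀ z ∈ D, c z = o z) →
      step^[K] ⟨x, v, c⟩ = rev ⟨x, v, c * F⟩

/-- One run in the configuration `o` suffices: the path reads only sites of `D`, so every
configuration that agrees with `o` there produces the same path and the same flips. -/
theorem reflects_of_path {x v : ℤ × ℤ} {D : Finset (ℤ × ℤ)} {o : ℤ × ℤ → ℤˣ} (K : ℕ)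
    (hD : ∀ j < K, (step^[j + 1] ⟨x, v, o⟩).pos ∈ D)
    (hpos : (step^[K] ⟨x, v, o⟩).pos = x + v) (hvel : (step^[K] ⟨x, v, o⟩).vel = -v) :
    Reflects x v D o := by
  have sq (u : ℤˣ) : u * u = 1 := by rcases Int.units_eq_one_or u with h | h <;> simp [h]
  refine ⟨K, o * (step^[K] ⟨x, v, o⟩).cfg, fun z hz => ?_, fun c hc => ?_⟩
  · rw [Pi.mul_apply, cfg_iterate_step fun j hj h => hz (by rw [← h]; exact hD j hj)]
    exact sq _
  -- Signs square to `1`, so `o * c` turns `o` into `c` and is trivial on `D`.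
  · have h1 : (⟨x, v, c⟩ : LState) = twist (o * c) ⟨x, v, o⟩ := by
      ext1
      · rfl
      · rfl
      · funext z; simp [twist, ← mul_assoc, sq]
    rw [h1, iterate_step_twist fun j hj => by rw [Pi.mul_apply, hc _ (hD j hj), sq]]
    ext1
    · exact hpos
    · exact hvel
    · funext z; simp only [twist, rev, Pi.mul_apply]; rw [mul_comm, mul_comm (o z) (c z), mul_assoc]

/-- Multiplication of Eisenstein integers in triangular coordinates. -/
def emul (u z : ℤ × ℤ) : ℤ × ℤ := (u.1 * z.1 - u.2 * z.2, u.1 * z.2 + u.2 * z.1 + u.2 * z.2)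

theorem emul_add (u z w : ℤ × ℤ) : emul u (z + w) = emul u z + emul u w := by
  ext <;> simp [emul] <;> ring

theorem emul_neg (u z : ℤ × ℤ) : emul u (-z) = -emul u z := by
  ext <;> simp [emul] <;> ring

theorem turn_emul (u v : ℤ × ℤ) (z : ℤˣ) : turn z (emul u v) = emul u (turn z v) := by
  rcases Int.units_eq_one_or z with rfl | rfl <;> ext <;> simp [turn, emul] <;> ring

/-- Rotation by the unit `u` followed by a translation. -/
def affine (p u z : ℤ × ℤ) : ℤ × ℤ := p + emul u z

theorem emul_injective {u : ℤ × ℤ} (hu : u.1 ^ 2 + u.1 * u.2 + u.2 ^ 2 = 1) :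
    Function.Injective (emul u) := by
  -- The left factor is the conjugate of `u`, which inverts an element of norm one.
  have key (z : ℤ × ℤ) : emul (u.1 + u.2, -u.2) (emul u z) = z := by
    ext <;> simp only [emul]
    · linear_combination z.1 * hu
    · linear_combination z.2 * hu
  exact Function.LeftInverse.injective key

/-- Turns are multiplications by Eisenstein units, hence commute with rotations. The configurations
need to correspond only on the image of the map. -/
theorem step_affine {p u : ℤ × ℤ} (hu : Function.Injective (affine p u)) {s s' : LState}
    (hp : s'.pos = affine p u s.pos) (hv : s'.vel = emul u s.vel)
    (hc : ∀ z, s'.cfg (affine p u z) = s.cfg z) :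
    s'.step.pos = affine p u s.step.pos ∧ s'.step.vel = emul u s.step.vel ∧
      ∀ z, s'.step.cfg (affine p u z) = s.step.cfg z := by
  have h : s'.pos + s'.vel = affine p u (s.pos + s.vel) := by
    rw [hp, hv, affine, affine, emul_add, add_assoc]
  refine ⟨h, ?_, fun z => ?_⟩
  · change turn (s'.cfg (s'.pos + s'.vel)) s'.vel = _
    rw [h, hc, hv, turn_emul]; rfl
  · simp only [step, h, hc, Function.update_apply, hu.eq_iff]

theorem iterate_step_affine {p u : ℤ × ℤ} (hu : Function.Injective (affine p u)) {s s' : LState}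
    (hp : s'.pos = affine p u s.pos) (hv : s'.vel = emul u s.vel)
    (hc : ∀ z, s'.cfg (affine p u z) = s.cfg z) (k : ℕ) :
    (step^[k] s').pos = affine p u (step^[k] s).pos ∧
      (step^[k] s').vel = emul u (step^[k] s).vel ∧
      ∀ z, (step^[k] s').cfg (affine p u z) = (step^[k] s).cfg z := by
  induction k with
  | zero => exact ⟨hp, hv, hc⟩
  | succ k ih =>
    simp only [Function.iterate_succ_apply']
    exact step_affine hu ih.1 ih.2.1 ih.2.2

/-- A reflecting pattern at the origin, with orientation `1` on the sites `R` and `-1` on the sites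
`D \ R`. -/
def IsMirror (v : ℤ × ℤ) (D R : List (ℤ × ℤ)) (K : ℕ) : Prop :=
  (∀ j < K, (step^[j + 1] ⟨-v, v, fun z => if z ∈ R then 1 else -1⟩).pos ∈ D) ∧
    (step^[K] ⟨-v, v, fun z => if z ∈ R then 1 else -1⟩).pos = 0 ∧
    (step^[K] ⟨-v, v, fun z => if z ∈ R then 1 else -1⟩).vel = -v

/-- The orientation at `z`, if initially it is `1` on the sites `R` and `-1` elsewhere, after the
sites in the list `seen` have been visited. -/
def orientationAfter (R seen : List (ℤ × ℤ)) (z : ℤ × ℤ) : ℤˣ :=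
  (if z ∈ R then 1 else -1) * (-1) ^ seen.count z

/-- Checks that a particle on the bond from `a` to `b`, with the orientations that are left by the
visits to `seen`, follows the path `l` after `b`, visits only `D` on it, and ends up on the bond from
`e` to `e'`. -/
def checkPath (D R : List (ℤ × ℤ)) (e e' : ℤ × ℤ) (seen : List (ℤ × ℤ)) (a b : ℤ × ℤ) :
    List (ℤ × ℤ) → Bool
  | [] => a = e && b = e'
  | c :: l => b ∈ D && c = b + turn (orientationAfter R seen b) (b - a) &&
      checkPath D R e e' (b :: seen) b c l

theorem iterate_step_of_checkPath {D R : List (ℤ × ℤ)} {e e' a b : ℤ × ℤ}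
    {seen l : List (ℤ × ℤ)} (h : checkPath D R e e' seen a b l) :
    (∀ j < l.length, (step^[j + 1] ⟨a, b - a, orientationAfter R seen⟩).pos ∈ D) ∧
      (step^[l.length] ⟨a, b - a, orientationAfter R seen⟩).pos = e ∧
      (step^[l.length] ⟨a, b - a, orientationAfter R seen⟩).vel = e' - e := by
  induction l generalizing seen a b with
  | nil =>
    simp only [checkPath, Bool.and_eq_true, decide_eq_true_eq] at h
    obtain ⟨rfl, rfl⟩ := h
    exact ⟨fun j hj => absurd hj (Nat.not_lt_zero j), rfl, rfl⟩
  | cons c l ih =>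
    simp only [checkPath, Bool.and_eq_true, decide_eq_true_eq] at h
    obtain ⟨⟨hb, hc⟩, h⟩ := h
    have hs : step ⟨a, b - a, orientationAfter R seen⟩ =
        ⟨b, c - b, orientationAfter R (b :: seen)⟩ := by
      ext1
      · simp [step]
      · simp [step, hc]
      · funext z
        by_cases hz : z = b
        · subst hz
          simp [step, orientationAfter, pow_succ]
        · simp [step, orientationAfter, hz, List.count_cons_of_ne (Ne.symm hz)]
    have ih := ih h
    rw [← hs] at ih
    refine ⟨fun j hj => ?_, ih.2⟩
    cases j with
    | zero =>
      change (step ⟨a, b - a, orientationAfter R seen⟩).pos ∈ D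
      rw [hs]
      exact hb
    | succ j => exact ih.1 j (by simpa using hj)

theorem isMirror_of_checkPath {v : ℤ × ℤ} {D R l : List (ℤ × ℤ)}
    (h : checkPath D R 0 (-v) [] (-v) 0 l) : IsMirror v D R l.length := by
  have key := iterate_step_of_checkPath h
  have h0 : orientationAfter R [] = fun z => if z ∈ R then 1 else -1 := by
    funext z; simp [orientationAfter]
  simpa [IsMirror, h0] using key

theorem IsMirror.reflects {v : ℤ × ℤ} {D R : List (ℤ × ℤ)} {K : ℕ} (h : IsMirror v D R K)
    (x : ℤ × ℤ) {u : ℤ × ℤ} (hu : u.1 ^ 2 + u.1 * u.2 + u.2 ^ 2 = 1) :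
    ∃ o, Reflects x (emul u v) (D.toFinset.image (affine (x + emul u v) u)) o := by
  have hi : Function.Injective (affine (x + emul u v) u) :=
    (add_right_injective _).comp (emul_injective hu)
  set o₀ : ℤ × ℤ → ℤˣ := fun z => if z ∈ R then 1 else -1
  set o : ℤ × ℤ → ℤˣ := fun z => o₀ (Function.invFun (affine (x + emul u v) u) z) with ho
  have key := iterate_step_affine hi (s := ⟨-v, v, o₀⟩) (s' := ⟨x, emul u v, o⟩)
    (by simp [affine, emul_neg]) rfl (fun z => by simp [ho, Function.leftInverse_invFun hi z])
  refine ⟨o, reflects_of_path K (fun j hj => ?_) ?_ ?_⟩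
  · rw [(key _).1]
    exact Finset.mem_image_of_mem _ (List.mem_toFinset.2 (h.1 j hj))
  · rw [(key _).1, h.2.1]
    simp [affine, emul]
  · rw [(key _).2.1, h.2.2, emul_neg]

/-! ### Periodicity from mirrors at the two ends of a trajectory -/

namespace LState

/-- The states that the dynamics reaches from `s`. -/
def Reaches (s s' : LState) : Prop := ∃ k, step^[k] s = s'

theorem Reaches.trans {s s' s'' : LState} (h : s.Reaches s') (h' : s'.Reaches s'') :
    s.Reaches s'' := by
  obtain ⟨k, rfl⟩ := h
  obtain ⟨l, rfl⟩ := h'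
  exact ⟨l + k, Function.iterate_add_apply _ _ _ _⟩

theorem reaches_twist {G : ℤ × ℤ → ℤˣ} {s : LState} {k : ℕ} {B : Set (ℤ × ℤ)}
    (hB : ∀ j < k, (step^[j + 1] s).pos ∈ B) (hG : ∀ z ∈ B, G z = 1) :
    (s.twist G).Reaches ((step^[k] s).twist G) :=
  ⟨k, iterate_step_twist fun j hj => hG _ (hB j hj)⟩

theorem reaches_rev_twist {G : ℤ × ℤ → ℤˣ} {s : LState} {k : ℕ} {B : Set (ℤ × ℤ)}
    (hB : ∀ j < k, (step^[j + 1] s).pos ∈ B) (hG : ∀ z ∈ B, G z = 1) :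
    ((step^[k] s).twist G).rev.Reaches (s.rev.twist G) :=
  ⟨k, by rw [← iterate_step_twist fun j hj => hG _ (hB j hj), iterate_step_rev]; rfl⟩

theorem reaches_rev {s : LState} {k : ℕ} : (step^[k] s).rev.Reaches s.rev :=
  ⟨k, iterate_step_rev k s⟩

theorem exists_period_of_reaches {s : LState} {k : ℕ} (hk : 0 < k) (h : (step^[k] s).Reaches s) :
    ∃ T, 0 < T ∧ step^[T] s = s := by
  obtain ⟨l, hl⟩ := h
  exact ⟨l + k, by omega, by rw [Function.iterate_add_apply, hl]⟩

theorem exists_period_of_rev {s : LState} (h : ∃ T, 0 < T ∧ step^[T] s.rev = s.rev) :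
    ∃ T, 0 < T ∧ step^[T] s = s := by
  obtain ⟨T, hT, h⟩ := h
  refine ⟨T, hT, ?_⟩
  have := iterate_step_rev T s.rev
  rwa [h, rev_rev] at this

/-- The bonds of the two ends of a trajectory both carry a reflecting pattern. -/
theorem exists_period_of_reflects {s : LState} {k k' : ℕ} {B : Set (ℤ × ℤ)}
    {D D' : Finset (ℤ × ℤ)} {o o' : ℤ × ℤ → ℤˣ} (hk : 0 < k)
    (hB : ∀ j < k, (step^[j + 1] s).pos ∈ B) (hB' : ∀ j < k', (step^[j + 1] s.rev).pos ∈ B)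
    (hr : Reflects (step^[k] s).pos (step^[k] s).vel D o)
    (hr' : Reflects (step^[k'] s.rev).pos (step^[k'] s.rev).vel D' o')
    (hD : ∀ z ∈ B, z ∉ D) (hD' : ∀ z ∈ B, z ∉ D') (hDD' : Disjoint D D')
    (ho : ∀ z ∈ D, s.cfg z = o z) (ho' : ∀ z ∈ D', s.cfg z = o' z) :
    ∃ T, 0 < T ∧ step^[T] s = s := by
  obtain ⟨K, F, hF, hK⟩ := hr
  obtain ⟨K', F', hF', hK'⟩ := hr'
  have hFB : ∀ z ∈ B, F z = 1 := fun z hz => hF z (hD z hz)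
  have hFB' : ∀ z ∈ B, F' z = 1 := fun z hz => hF' z (hD' z hz)
  set A := step^[k] s with hA
  set A' := step^[k'] s.rev with hA'
  have cA : ∀ z ∈ D, A.cfg z = o z := fun z hz => by
    rw [← ho z hz]; exact cfg_iterate_step fun j hj h => hD _ (hB j hj) (by rwa [h])
  have cA' : ∀ z ∈ D', A'.cfg z = o' z := fun z hz => by
    rw [← ho' z hz]; exact cfg_iterate_step fun j hj h => hD' _ (hB' j hj) (by rwa [h])
  -- `r1` and `r4` are the first visits to the two mirrors. Reversing a reflection yields the second
  -- visits `r3` and `r5`, which remove `F` and `F'`; each mirror is unaffected by the state of the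
  -- other because `D` and `D'` are disjoint.
  have r1 : A.Reaches (A.twist F).rev := ⟨K, hK _ cA⟩
  have r2 : step^[K] (A.twist F') = ((A.twist F').twist F).rev := hK _ fun z hz => by
    change A.cfg z * F' z = _
    rw [cA z hz, hF' z (Finset.disjoint_left.1 hDD' hz), mul_one]
  have r3 : ((A.twist F).twist F').Reaches (A.twist F').rev := by
    rw [twist_twist]
    refine ⟨K, ?_⟩
    rw [← rev_rev ((A.twist F').twist F), ← r2, iterate_step_rev]
  have r4 : (A'.twist F).Reaches ((A'.twist F).twist F').rev := ⟨K', hK' _ fun z hz => by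
    change A'.cfg z * F z = _
    rw [cA' z hz, hF z (Finset.disjoint_right.1 hDD' hz), mul_one]⟩
  have r5 : (A'.twist F').Reaches A'.rev := by
    refine ⟨K', ?_⟩
    have h : step^[K'] A' = (A'.twist F').rev := hK' _ cA'
    rw [← rev_rev (A'.twist F'), ← h, iterate_step_rev]
  have hFF' : ∀ z ∈ B, (F * F') z = 1 := fun z hz => by simp [hFB z hz, hFB' z hz]
  have tt (t : LState) : (t.twist F).twist F' = t.twist (F * F') := by
    ext <;> simp [twist, mul_assoc]
  refine exists_period_of_reaches hk (r1.trans ?_)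
  refine (reaches_rev_twist hB hFB).trans ?_
  refine (reaches_twist hB' hFB).trans (r4.trans ?_)
  rw [tt]
  refine (reaches_rev_twist hB' hFF').trans ?_
  rw [rev_rev]
  refine (reaches_twist hB hFF').trans ?_
  rw [← tt]
  refine r3.trans ((reaches_rev_twist hB hFB').trans ?_)
  refine (reaches_twist hB' hFB').trans (r5.trans ?_)
  have := reaches_rev (s := s.rev) (k := k')
  rwa [rev_rev] at this

/-- The two ends of a trajectory leave through the same bond, which carries a reflecting pattern. -/
theorem exists_period_of_reflects_same {s : LState} {k k' : ℕ} {B : Set (ℤ × ℤ)}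
    {D : Finset (ℤ × ℤ)} {o : ℤ × ℤ → ℤˣ} (hk : 0 < k)
    (hB : ∀ j < k, (step^[j + 1] s).pos ∈ B) (hB' : ∀ j < k', (step^[j + 1] s.rev).pos ∈ B)
    (hr : Reflects (step^[k] s).pos (step^[k] s).vel D o)
    (hpos : (step^[k'] s.rev).pos = (step^[k] s).pos)
    (hvel : (step^[k'] s.rev).vel = (step^[k] s).vel)
    (hD : ∀ z ∈ B, z ∉ D) (ho : ∀ z ∈ D, s.cfg z = o z) :
    ∃ T, 0 < T ∧ step^[T] s = s := by
  obtain ⟨K, F, hF, hK⟩ := hr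
  have hFB : ∀ z ∈ B, F z = 1 := fun z hz => hF z (hD z hz)
  set A := step^[k] s with hA
  set A' := step^[k'] s.rev with hA'
  have cA : ∀ z ∈ D, A.cfg z = o z := fun z hz => by
    rw [← ho z hz]; exact cfg_iterate_step fun j hj h => hD _ (hB j hj) (by rwa [h])
  have cA' : ∀ z ∈ D, A'.cfg z = o z := fun z hz => by
    rw [← ho z hz]; exact cfg_iterate_step fun j hj h => hD _ (hB' j hj) (by rwa [h])
  have r1 : A.Reaches (A.twist F).rev := ⟨K, hK _ cA⟩
  -- The backward end arrives at the same mirror, already changed by `F`, and runs it in reverse.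
  have r2 : (A'.twist F).Reaches A'.rev := by
    refine ⟨K, ?_⟩
    have h : step^[K] A' = (A'.twist F).rev := by
      have := hK _ cA'
      rw [← hpos, ← hvel] at this
      exact this
    rw [← rev_rev (A'.twist F), ← h, iterate_step_rev]
  refine exists_period_of_reaches hk (r1.trans ?_)
  refine (reaches_rev_twist hB hFB).trans ?_
  refine (reaches_twist hB' hFB).trans (r2.trans ?_)
  have := reaches_rev (s := s.rev) (k := k')
  rwa [rev_rev] at this

end LState

/-! ### Admissible states and confined trajectories -/

/-- The unit velocities in triangular coordinates. -/
def units : Finset (ℤ × ℤ) := {(1, 0), (0, 1), (-1, 1), (-1, 0), (0, -1), (1, -1)}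

/-- The position is on the honeycomb lattice and the velocity is along one of its bonds. -/
def LState.OnBond (s : LState) : Prop :=
  s.vel ∈ units ∧ ((s.pos.1 - s.pos.2) % 3 = 0 ∧ (s.vel.1 - s.vel.2) % 3 = 1 ∨
    (s.pos.1 - s.pos.2) % 3 = 1 ∧ (s.vel.1 - s.vel.2) % 3 = 2)

theorem turn_mem_units (z : ℤˣ) {v : ℤ × ℤ} (hv : v ∈ units) : turn z v ∈ units := by
  revert v
  rcases Int.units_eq_one_or z with rfl | rfl <;> decide

theorem LState.OnBond.step {s : LState} (h : s.OnBond) : s.step.OnBond := by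
  refine ⟨turn_mem_units _ h.1, ?_⟩
  have h2 := h.2
  simp only [LState.step, turn, Prod.fst_add, Prod.snd_add]
  split_ifs <;> simp only [] <;> omega

theorem LState.OnBond.iterate_step {s : LState} (h : s.OnBond) (k : ℕ) :
    (LState.step^[k] s).OnBond := by
  induction k with
  | zero => exact h
  | succ k ih => rw [Function.iterate_succ_apply']; exact ih.step

theorem LState.OnBond.exists_period {s : LState} (h : s.OnBond) {B : Finset (ℤ × ℤ)}
    (hB : ∀ j, (LState.step^[j] s).pos ∈ B) : ∃ T, 0 < T ∧ LState.step^[T] s = s := by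
  -- Orientations outside `B` never change, so these finitely many data determine the state.
  let g (j : ℕ) : B × units × (B → ℤˣ) :=
    (⟨_, hB j⟩, ⟨_, (h.iterate_step j).1⟩, fun z => (LState.step^[j] s).cfg z)
  have hg : ∀ i j, g i = g j → LState.step^[i] s = LState.step^[j] s := fun i j hij => by
    simp only [g, Prod.mk.injEq, Subtype.mk.injEq] at hij
    ext1
    · exact hij.1
    · exact hij.2.1
    · funext z
      by_cases hz : z ∈ B
      · exact congrFun hij.2.2 ⟨z, hz⟩
      · rw [cfg_iterate_step fun j _ h' => hz (by rw [← h']; exact hB _),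
          cfg_iterate_step fun j _ h' => hz (by rw [← h']; exact hB _)]
  have key : ∀ i j, i < j → g i = g j → ∃ T, 0 < T ∧ LState.step^[T] s = s :=
    fun i j hij h => ⟨j - i, by omega, by
      apply step_injective.iterate i
      rw [← Function.iterate_add_apply, Nat.add_sub_cancel' hij.le, hg i j h]⟩
  obtain ⟨i, j, hij, h⟩ := Finite.exists_ne_map_eq_of_infinite g
  rcases hij.lt_or_gt with hij | hij
  · exact key i j hij h
  · exact key j i hij h.symm

/-! ### Geometry of the triangle -/

/-- The triangle in which `a`, `b` and `-(a + b)` are at most `N`. -/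
noncomputable def tri (N : ℤ) : Finset (ℤ × ℤ) :=
  {z ∈ Finset.Icc (-2 * N) N ×ˢ Finset.Icc (-2 * N) N | -N ≤ z.1 + z.2}

theorem mem_tri {N : ℤ} {z : ℤ × ℤ} : z ∈ tri N ↔ z.1 ≤ N ∧ z.2 ≤ N ∧ -N ≤ z.1 + z.2 := by
  simp only [tri, Finset.mem_filter, Finset.mem_product, Finset.mem_Icc]
  omega

/-- The linear form that is maximal on the side `i` of the triangle. -/
def height : Fin 3 → ℤ × ℤ → ℤ
  | 0, z => z.1
  | 1, z => z.2
  | 2, z => -(z.1 + z.2)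

/-- The coordinate along the side `i` of the triangle. -/
def width : Fin 3 → ℤ × ℤ → ℤ
  | 0, z => z.1 + 2 * z.2
  | 1, z => -2 * z.1 - z.2
  | 2, z => z.1 - z.2

/-- The rotation that carries side `0` of the triangle to side `i`. -/
def sideUnit : Fin 3 → ℤ × ℤ
  | 0 => (1, 0)
  | 1 => (-1, 1)
  | 2 => (0, -1)

theorem sideUnit_norm (i : Fin 3) :
    (sideUnit i).1 ^ 2 + (sideUnit i).1 * (sideUnit i).2 + (sideUnit i).2 ^ 2 = 1 := by
  fin_cases i <;> rfl

theorem height_affine (i : Fin 3) (y d : ℤ × ℤ) :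
    height i (affine y (sideUnit i) d) = height i y + d.1 := by
  fin_cases i <;> simp [height, affine, sideUnit, emul]; ring

theorem width_affine (i : Fin 3) (y d : ℤ × ℤ) :
    width i (affine y (sideUnit i) d) = width i y + (d.1 + 2 * d.2) := by
  fin_cases i <;> simp [width, affine, sideUnit, emul] <;> ring

theorem width_emod (i : Fin 3) (z : ℤ × ℤ) : width i z % 3 = (z.1 - z.2) % 3 := by
  fin_cases i <;> simp only [width] <;> omega

/-! ### Mirrors outside a side -/

/-- A reflecting pattern for the bond from `x` in direction `v` that lies outside the side `i`. -/
structure SidePattern (i : Fin 3) (x v : ℤ × ℤ) (D : Finset (ℤ × ℤ)) : Prop where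
  card : D.card ≤ 20
  mem_honeycomb : ∀ z ∈ D, (z.1 - z.2) % 3 ≠ 2
  height_ge : ∀ z ∈ D, height i (x + v) ≤ height i z
  near : ∀ z ∈ D, z.1 - (x + v).1 ≤ 10 ∧ z.2 - (x + v).2 ≤ 10 ∧
    -10 ≤ z.1 + z.2 - (x + v).1 - (x + v).2
  reflects : ∃ o, Reflects x v D o

/-- Rotations by 120 degrees preserve `a - b` modulo 3, so it is enough to check side `0`; `r` is
the residue of the site where the pattern is entered. -/
theorem IsMirror.exists_sidePattern {v₀ : ℤ × ℤ} {D R : List (ℤ × ℤ)} {K : ℕ}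
    (h : IsMirror v₀ D R K) (hlen : D.length ≤ 20) {r : ℤ}
    (hD : ∀ d ∈ D, 0 ≤ d.1 ∧ (d.1 - d.2 + r) % 3 ≠ 2 ∧
      -10 ≤ d.1 ∧ d.1 ≤ 10 ∧ -10 ≤ d.2 ∧ d.2 ≤ 10 ∧ -10 ≤ d.1 + d.2 ∧ d.1 + d.2 ≤ 10)
    (i : Fin 3) {x v : ℤ × ℤ} (hv : v = emul (sideUnit i) v₀)
    (hr : ((x + v).1 - (x + v).2) % 3 = r % 3) :
    SidePattern i x v (D.toFinset.image (affine (x + v) (sideUnit i))) := by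
  subst hv
  constructor
  · exact Finset.card_image_le.trans ((List.toFinset_card_le D).trans hlen)
  · intro z hz
    obtain ⟨d, hd, rfl⟩ := Finset.mem_image.1 hz
    have h1 := hD d (List.mem_toFinset.1 hd)
    rw [← width_emod i, width_affine]
    have := width_emod i (x + emul (sideUnit i) v₀)
    omega
  · intro z hz
    obtain ⟨d, hd, rfl⟩ := Finset.mem_image.1 hz
    have h1 := hD d (List.mem_toFinset.1 hd)
    rw [height_affine]
    omega
  · intro z hz
    obtain ⟨d, hd, rfl⟩ := Finset.mem_image.1 hz
    have h1 := hD d (List.mem_toFinset.1 hd)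
    generalize x + emul (sideUnit i) v₀ = y
    fin_cases i <;> simp only [affine, sideUnit, emul, Prod.fst_add, Prod.snd_add] <;> omega
  · exact h.reflects x (sideUnit_norm i)

/-- The sites of a pattern, on the left of side `0`, that reflects a particle with velocity
`(1, 0)`. -/
def mirrorAL : List (ℤ × ℤ) :=
    [(0, 0), (1, -1), (1, -2), (2, -3), (2, -4), (1, -4), (1, -5), (2, -6), (3, -6), (4, -7),
    (5, -7), (5, -6), (4, -5), (4, -4), (5, -4), (5, -3), (4, -2), (3, -2), (3, -3), (3, -5)]

theorem isMirror_mirrorAL : IsMirror (1, 0) mirrorAL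
    [(0, 0), (1, -1), (2, -3), (2, -4), (3, -6), (4, -5), (4, -4), (3, -3)] 29 := by
  -- As in the other three mirrors, the path makes a wide excursion that shares three edges with a
  -- hexagon, then goes once around this hexagon and leaves along the stem by which it came.
  refine isMirror_of_checkPath (l :=
    [(1, -1), (1, -2), (2, -3), (2, -4), (1, -4), (1, -5), (2, -6), (3, -6), (4, -7), (5, -7),
    (5, -6), (4, -5), (4, -4), (5, -4), (5, -3), (4, -2), (3, -2), (3, -3), (2, -3), (2, -4),
    (3, -5), (4, -5), (4, -4), (3, -3), (2, -3), (1, -2), (1, -1), (0, 0), (-1, 0)]) ?_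
  decide

/-- The sites of a pattern, on the right of side `0`, that reflects a particle with velocity
`(1, 0)`. -/
def mirrorAR : List (ℤ × ℤ) :=
    [(0, 0), (0, 1), (1, 1), (2, 0), (2, -1), (3, -2), (4, -2), (4, -1), (5, -1), (5, 0),
    (4, 1), (3, 1), (2, 2), (2, 3), (1, 4), (0, 4), (0, 3), (1, 2), (3, 0)]

theorem isMirror_mirrorAR : IsMirror (1, 0) mirrorAR
    [(0, 1), (1, 1), (2, 0), (4, -1), (3, 1), (2, 2), (1, 2)] 27 := by
  refine isMirror_of_checkPath (l :=
    [(0, 1), (1, 1), (2, 0), (2, -1), (3, -2), (4, -2), (4, -1), (5, -1), (5, 0), (4, 1),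
    (3, 1), (2, 2), (2, 3), (1, 4), (0, 4), (0, 3), (1, 2), (1, 1), (2, 0), (3, 0), (3, 1), (2, 2),
    (1, 2), (1, 1), (0, 1), (0, 0), (-1, 0)]) ?_
  decide

/-- The sites of a pattern, on the left of side `0`, that reflects a particle with velocity
`(1, -1)`. -/
def mirrorBL : List (ℤ × ℤ) :=
    [(0, 0), (0, -1), (1, -2), (1, -3), (0, -3), (0, -4), (1, -5), (2, -5), (3, -6), (4, -6),
    (4, -5), (3, -4), (3, -3), (4, -3), (4, -2), (3, -1), (2, -1), (2, -2), (2, -4)]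

theorem isMirror_mirrorBL : IsMirror (1, -1) mirrorBL
    [(0, 0), (1, -2), (1, -3), (2, -5), (3, -4), (3, -3), (2, -2)] 27 := by
  refine isMirror_of_checkPath (l :=
    [(0, -1), (1, -2), (1, -3), (0, -3), (0, -4), (1, -5), (2, -5), (3, -6), (4, -6), (4, -5),
    (3, -4), (3, -3), (4, -3), (4, -2), (3, -1), (2, -1), (2, -2), (1, -2), (1, -3), (2, -4),
    (3, -4), (3, -3), (2, -2), (1, -2), (0, -1), (0, 0), (-1, 1)]) ?_
  decide

/-- The sites of a pattern, on the right of side `0`, that reflects a particle with velocity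
`(1, -1)`. -/
def mirrorBR : List (ℤ × ℤ) :=
    [(0, 0), (1, 0), (1, 1), (2, 1), (3, 0), (3, -1), (4, -2), (5, -2), (5, -1), (6, -1),
    (6, 0), (5, 1), (4, 1), (3, 2), (3, 3), (2, 4), (1, 4), (1, 3), (2, 2), (4, 0)]

theorem isMirror_mirrorBR : IsMirror (1, -1) mirrorBR
    [(1, 1), (2, 1), (3, 0), (5, -1), (4, 1), (3, 2), (2, 2)] 29 := by
  refine isMirror_of_checkPath (l :=
    [(1, 0), (1, 1), (2, 1), (3, 0), (3, -1), (4, -2), (5, -2), (5, -1), (6, -1), (6, 0),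
    (5, 1), (4, 1), (3, 2), (3, 3), (2, 4), (1, 4), (1, 3), (2, 2), (2, 1), (3, 0), (4, 0), (4, 1),
    (3, 2), (2, 2), (2, 1), (1, 1), (1, 0), (0, 0), (-1, 1)]) ?_
  decide

/-- Up to rotation only two directions cross a side outwards, and the sublattice of the endpoint
decides between them. -/
theorem velocity_cases {i : Fin 3} {x v : ℤ × ℤ} (hx : OnBond ⟨x, v, 1⟩) (hi : height i v = 1) :
    v = emul (sideUnit i) (1, 0) ∧ ((x + v).1 - (x + v).2) % 3 = 1 % 3 ∨
      v = emul (sideUnit i) (1, -1) ∧ ((x + v).1 - (x + v).2) % 3 = 0 % 3 := by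
  obtain ⟨hv, hc⟩ := hx
  simp only [] at hv hc
  have key : ∀ v ∈ units, ∀ i, height i v = 1 →
      v = emul (sideUnit i) (1, 0) ∧ (v.1 - v.2) % 3 = 1 ∨
        v = emul (sideUnit i) (1, -1) ∧ (v.1 - v.2) % 3 = 2 := by decide
  simp only [Prod.fst_add, Prod.snd_add]
  rcases key v hv i hi with h | h
  · exact Or.inl ⟨h.1, by omega⟩
  · exact Or.inr ⟨h.1, by omega⟩

/-- The side is cut into cells of width three, and `/ 3` is the index of the cell. The mirror does
not go past the cell of its entrance. -/
theorem exists_sidePattern_left {i : Fin 3} {x v : ℤ × ℤ} (hx : OnBond ⟨x, v, 1⟩)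
    (hi : height i v = 1) : ∃ D, SidePattern i x v D ∧
      ∀ z ∈ D, width i z / 3 ≤ width i (x + v) / 3 := by
  rcases velocity_cases hx hi with ⟨hv, hr⟩ | ⟨hv, hr⟩
  · refine ⟨_, isMirror_mirrorAL.exists_sidePattern (by decide) (r := 1) (by decide) i hv hr,
      fun z hz => ?_⟩
    obtain ⟨d, hd, rfl⟩ := Finset.mem_image.1 hz
    have h1 : ∀ d ∈ mirrorAL, d.1 + 2 * d.2 ≤ 0 := by decide
    have h2 := h1 d (List.mem_toFinset.1 hd)
    have h3 := width_emod i (x + v)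
    rw [width_affine]
    omega
  · refine ⟨_, isMirror_mirrorBL.exists_sidePattern (by decide) (r := 0) (by decide) i hv hr,
      fun z hz => ?_⟩
    obtain ⟨d, hd, rfl⟩ := Finset.mem_image.1 hz
    -- The entrance has residue 0 here, so an overhang of 1 stays in its cell.
    have h1 : ∀ d ∈ mirrorBL, d.1 + 2 * d.2 ≤ 1 := by decide
    have h2 := h1 d (List.mem_toFinset.1 hd)
    have h3 := width_emod i (x + v)
    rw [width_affine]
    omega

theorem exists_sidePattern_right {i : Fin 3} {x v : ℤ × ℤ} (hx : OnBond ⟨x, v, 1⟩)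
    (hi : height i v = 1) : ∃ D, SidePattern i x v D ∧
      ∀ z ∈ D, width i (x + v) / 3 ≤ width i z / 3 := by
  rcases velocity_cases hx hi with ⟨hv, hr⟩ | ⟨hv, hr⟩
  · refine ⟨_, isMirror_mirrorAR.exists_sidePattern (by decide) (r := 1) (by decide) i hv hr,
      fun z hz => ?_⟩
    obtain ⟨d, hd, rfl⟩ := Finset.mem_image.1 hz
    -- The entrance has residue 1 here, so one unit to the left stays in its cell.
    have h1 : ∀ d ∈ mirrorAR, -1 ≤ d.1 + 2 * d.2 := by decide
    have h2 := h1 d (List.mem_toFinset.1 hd)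
    have h3 := width_emod i (x + v)
    rw [width_affine]
    omega
  · refine ⟨_, isMirror_mirrorBR.exists_sidePattern (by decide) (r := 0) (by decide) i hv hr,
      fun z hz => ?_⟩
    obtain ⟨d, hd, rfl⟩ := Finset.mem_image.1 hz
    have h1 : ∀ d ∈ mirrorBR, 0 ≤ d.1 + 2 * d.2 := by decide
    have h2 := h1 d (List.mem_toFinset.1 hd)
    have h3 := width_emod i (x + v)
    rw [width_affine]
    omega

/-! ### Exits from the triangle and disjoint mirrors -/

/-- The side through which a bond leaves the triangle. -/
theorem exists_side {N : ℤ} {x v : ℤ × ℤ} (hv : v ∈ units) (hx : x ∈ tri N) (hy : x + v ∉ tri N) :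
    ∃ i, height i v = 1 ∧ height i x = N := by
  have key : ∀ v ∈ units, v.1 ≤ 1 ∧ v.2 ≤ 1 ∧ -1 ≤ v.1 + v.2 := by decide
  have h1 := key v hv
  rw [mem_tri] at hx hy
  simp only [Prod.fst_add, Prod.snd_add] at hy
  by_cases ha : x.1 + v.1 ≤ N
  · by_cases hb : x.2 + v.2 ≤ N
    · exact ⟨2, by simp only [height]; omega, by simp only [height]; omega⟩
    · exact ⟨1, by simp only [height]; omega, by simp only [height]; omega⟩
  · exact ⟨0, by simp only [height]; omega, by simp only [height]; omega⟩

theorem height_add (i : Fin 3) (z w : ℤ × ℤ) : height i (z + w) = height i z + height i w := by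
  fin_cases i <;> simp [height]; ring

theorem SidePattern.mem {i : Fin 3} {N : ℤ} {x v : ℤ × ℤ} {D : Finset (ℤ × ℤ)}
    (h : SidePattern i x v D) (hv : v ∈ units) (hx : x ∈ tri N) (hi : height i v = 1)
    (hN : height i x = N) :
    ∀ z ∈ D, (z.1 - z.2) % 3 ≠ 2 ∧ z ∉ tri N ∧ z ∈ tri (N + 20) := by
  intro z hz
  have key : ∀ v ∈ units, v.1 ≤ 1 ∧ v.2 ≤ 1 ∧ -1 ≤ v.1 + v.2 := by decide
  have h1 := key v hv
  have h2 := h.near z hz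
  have h3 := h.height_ge z hz
  rw [height_add, hi, hN] at h3
  refine ⟨h.mem_honeycomb z hz, ?_, ?_⟩
  · rw [mem_tri]
    fin_cases i <;> simp only [height] at h3 <;> omega
  · rw [mem_tri] at hx ⊢
    simp only [Prod.fst_add, Prod.snd_add] at h2
    omega

theorem height_le_one {v : ℤ × ℤ} (hv : v ∈ units) (i : Fin 3) :
    height i v ≤ 1 ∧ (height i v = 1 → height (i + 1) v ≤ 0 ∧ height (i + 2) v ≤ 0) := by
  revert v i
  decide

theorem LState.OnBond.site {x v : ℤ × ℤ} (h : OnBond ⟨x, v, 1⟩) :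
    ((x + v).1 - (x + v).2) % 3 = 0 ∨ ((x + v).1 - (x + v).2) % 3 = 1 := by
  have := h.2
  simp only [Prod.fst_add, Prod.snd_add] at this ⊢
  omega

/-- Left patterns of a side are disjoint from right patterns of the next side. -/
theorem disjoint_sidePattern {i : Fin 3} {N : ℤ} {x v x' v' : ℤ × ℤ} {D D' : Finset (ℤ × ℤ)}
    (hb' : OnBond ⟨x', v', 1⟩) (hx' : x' ∈ tri N)
    (hi : height i v = 1) (hN : height i x = N)
    (hi' : height (i + 1) v' = 1) (hN' : height (i + 1) x' = N)
    (hD : SidePattern i x v D) (hD' : SidePattern (i + 1) x' v' D')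
    (hw : ∀ z ∈ D', width (i + 1) (x' + v') / 3 ≤ width (i + 1) z / 3) : Disjoint D D' := by
  refine Finset.disjoint_left.2 fun z hz hz' => ?_
  have h1 := hD.height_ge z hz
  have h2 := hD'.height_ge z hz'
  have h3 := hw z hz'
  have h4 := hb'.site
  have h5 := width_emod (i + 1) (x' + v')
  have h6 := ((height_le_one hb'.1 (i + 1)).2 hi').2
  have h7 : height i x' ≤ N := by
    rw [mem_tri] at hx'
    fin_cases i <;> simp only [height] <;> omega
  have h8 : i + 1 + 2 = i := by rw [add_assoc]; exact add_zero i
  rw [h8] at h6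
  have h9 : ∀ z, width (i + 1) z = -2 * height i z - height (i + 1) z := by
    intro z
    fin_cases i <;> simp [height, width] <;> ring
  rw [h9, h9] at h3
  rw [h9] at h5
  rw [height_add, hi, hN] at h1
  simp only [height_add] at h2 h3 h5
  simp only [] at h6
  -- A common site has both heights at least `N + 1`, hence width at most `-3 * N - 3`. The entrance
  -- `x' + v'` has width at least `-3 * N - 1`, and this value is excluded by its residue 2. So the
  -- common site lies in a strictly lower cell, contrary to `h3`.
  omega

/-- On one side, left patterns are disjoint from right patterns farther to the right. -/
theorem disjoint_sidePattern_same {i : Fin 3} {x v x' v' : ℤ × ℤ} {D D' : Finset (ℤ × ℤ)}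
    (h : width i (x + v) / 3 < width i (x' + v') / 3)
    (hD : ∀ z ∈ D, width i z / 3 ≤ width i (x + v) / 3)
    (hD' : ∀ z ∈ D', width i (x' + v') / 3 ≤ width i z / 3) : Disjoint D D' :=
  Finset.disjoint_left.2 fun z hz hz' => by have := hD z hz; have := hD' z hz'; omega

/-- Each cell contains at most one entrance: widths at equal height have equal parity, while the
residues 0 and 1 allowed in a cell are adjacent. The sublattice of the entrance then fixes the
velocity. -/
theorem eq_of_width_eq {i : Fin 3} {N : ℤ} {x v x' v' : ℤ × ℤ} (hb : OnBond ⟨x, v, 1⟩)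
    (hb' : OnBond ⟨x', v', 1⟩) (hi : height i v = 1) (hN : height i x = N)
    (hi' : height i v' = 1) (hN' : height i x' = N)
    (h : width i (x + v) / 3 = width i (x' + v') / 3) : x = x' ∧ v = v' := by
  have h1 := hb.site
  have h2 := hb'.site
  have h3 := width_emod i (x + v)
  have h4 := width_emod i (x' + v')
  have hy : height i (x + v) = height i (x' + v') := by rw [height_add, height_add]; omega
  have hxy : x + v = x' + v' := by
    generalize x + v = y at *
    generalize x' + v' = y' at *
    fin_cases i <;> simp only [height, width] at hy h h3 h4 <;> ext <;> omega
  have hv : v = v' := by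
    rcases velocity_cases hb hi with ⟨hv, hr⟩ | ⟨hv, hr⟩ <;>
      rcases velocity_cases hb' hi' with ⟨hv', hr'⟩ | ⟨hv', hr'⟩
    · rw [hv, hv']
    · rw [hxy] at hr; omega
    · rw [hxy] at hr; omega
    · rw [hv, hv']
  exact ⟨add_right_cancel (hxy.trans (by rw [hv])), hv⟩

/-- Patterns for two distinct bonds that leave the triangle can be chosen disjoint. -/
theorem exists_disjoint_sidePattern {i i' : Fin 3} {N : ℤ} {x v x' v' : ℤ × ℤ}
    (hb : OnBond ⟨x, v, 1⟩) (hb' : OnBond ⟨x', v', 1⟩) (hx : x ∈ tri N) (hx' : x' ∈ tri N)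
    (hi : height i v = 1) (hN : height i x = N) (hi' : height i' v' = 1) (hN' : height i' x' = N)
    (hne : ¬(x = x' ∧ v = v')) :
    ∃ D D', SidePattern i x v D ∧ SidePattern i' x' v' D' ∧ Disjoint D D' := by
  obtain ⟨L, hL, hLw⟩ := exists_sidePattern_left hb hi
  obtain ⟨R, hR, hRw⟩ := exists_sidePattern_right hb hi
  obtain ⟨L', hL', hLw'⟩ := exists_sidePattern_left hb' hi'
  obtain ⟨R', hR', hRw'⟩ := exists_sidePattern_right hb' hi'
  have hadj : ∀ i i' : Fin 3, i = i' ∨ i' = i + 1 ∨ i = i' + 1 := by decide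
  rcases hadj i i' with rfl | rfl | rfl
  · rcases lt_trichotomy (width i (x + v) / 3) (width i (x' + v') / 3) with h | h | h
    · exact ⟨L, R', hL, hR', disjoint_sidePattern_same h hLw hRw'⟩
    · exact absurd (eq_of_width_eq hb hb' hi hN hi' hN' h) hne
    · exact ⟨R, L', hR, hL', (disjoint_sidePattern_same h hLw' hRw).symm⟩
  · exact ⟨L, R', hL, hR', disjoint_sidePattern hb' hx' hi hN hi' hN' hL hR' hRw'⟩
  · exact ⟨R, L', hR, hL', (disjoint_sidePattern hb hx hi' hN' hi hN hL' hR hRw).symm⟩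

theorem LState.OnBond.with_cfg {s : LState} (h : s.OnBond) : OnBond ⟨s.pos, s.vel, 1⟩ := h

/-! ### Patterns that force periodicity -/

/-- Either a trajectory stays in the triangle or there is a first bond through which it leaves. -/
theorem exists_exit {s : LState} {N : ℤ} (hs : s.OnBond) (h0 : s.pos ∈ tri N)
    (h : ¬∀ j, (step^[j] s).pos ∈ tri N) :
    ∃ k, (∀ j < k, (step^[j + 1] s).pos ∈ tri N) ∧ (step^[k + 1] s).pos ∉ tri N ∧
      ∃ i, height i (step^[k] s).vel = 1 ∧ height i (step^[k] s).pos = N ∧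
        (step^[k] s).pos ∈ tri N := by
  classical
  push Not at h
  have hm (j : ℕ) (hj : j < Nat.find h) : (step^[j] s).pos ∈ tri N := not_not.1 (Nat.find_min h hj)
  have hsp := Nat.find_spec h
  obtain ⟨k, hk⟩ : ∃ k, Nat.find h = k + 1 :=
    Nat.exists_eq_succ_of_ne_zero fun h1 => by rw [h1] at hsp; exact hsp h0
  rw [hk] at hm hsp
  refine ⟨k, fun j hj => hm _ (by omega), hsp, ?_⟩
  rw [Function.iterate_succ_apply'] at hsp
  obtain ⟨i, hi⟩ := exists_side (hs.iterate_step k).1 (hm k (by omega)) hsp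
  exact ⟨i, hi.1, hi.2, hm k (by omega)⟩

/-- The initial state with configuration `c`. -/
def start (c : ℤ × ℤ → ℤˣ) : LState := ⟨0, (1, 0), c⟩

theorem start_onBond (c : ℤ × ℤ → ℤˣ) : (start c).OnBond := by
  change (1, 0) ∈ units ∧ (((0 : ℤ) - 0) % 3 = 0 ∧ ((1 : ℤ) - 0) % 3 = 1 ∨
    ((0 : ℤ) - 0) % 3 = 1 ∧ ((1 : ℤ) - 0) % 3 = 2)
  decide

theorem rev_start_onBond (c : ℤ × ℤ → ℤˣ) : (start c).rev.OnBond := by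
  change -(1, 0) ∈ units ∧ (((0 : ℤ) + 1 - (0 + 0)) % 3 = 0 ∧ (-(1 : ℤ) - -0) % 3 = 1 ∨
    ((0 : ℤ) + 1 - (0 + 0)) % 3 = 1 ∧ (-(1 : ℤ) - -0) % 3 = 2)
  decide

/-- Whatever the configuration in the triangle, finitely many orientations at sites outside it make
the trajectory periodic. -/
theorem exists_pattern {N : ℤ} (hN : 1 ≤ N) (c : ℤ × ℤ → ℤˣ) :
    ∃ (D : Finset (ℤ × ℤ)) (o : ℤ × ℤ → ℤˣ),
      (∀ z ∈ D, (z.1 - z.2) % 3 ≠ 2 ∧ z ∉ tri N ∧ z ∈ tri (N + 20)) ∧ D.card ≤ 40 ∧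
      ∀ c' : ℤ × ℤ → ℤˣ, (∀ z ∈ tri N, c' z = c z) → (∀ z ∈ D, c' z = o z) →
        ∃ T, 0 < T ∧ step^[T] (start c') = start c' := by
  have sq (u : ℤˣ) : u * u = 1 := by rcases Int.units_eq_one_or u with h | h <;> simp [h]
  have h0 : (start c).pos ∈ tri N := by
    rw [mem_tri]; change (0 : ℤ) ≤ N ∧ (0 : ℤ) ≤ N ∧ -N ≤ 0 + 0; omega
  have h0' : (start c).rev.pos ∈ tri N := by
    rw [mem_tri]; change (0 : ℤ) + 1 ≤ N ∧ (0 : ℤ) + 0 ≤ N ∧ -N ≤ 0 + 1 + (0 + 0); omega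
  have tw (c' : ℤ × ℤ → ℤˣ) : start c' = (start c).twist (c * c') := by
    ext1
    · rfl
    · rfl
    · funext z; simp [start, twist, ← mul_assoc, sq]
  have twB {c' : ℤ × ℤ → ℤˣ} (hc' : ∀ z ∈ tri N, c' z = c z) (z) (hz : z ∈ tri N) :
      (c * c') z = 1 := by
    rw [Pi.mul_apply, hc' z hz, sq]
  have twi {c' : ℤ × ℤ → ℤˣ} (hc' : ∀ z ∈ tri N, c' z = c z) {k : ℕ}
      (hk : ∀ j < k, (step^[j + 1] (start c)).pos ∈ tri N) :
      step^[k] (start c') = (step^[k] (start c)).twist (c * c') := by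
    rw [tw c']; exact iterate_step_twist fun j hj => twB hc' _ (hk j hj)
  have twi' {c' : ℤ × ℤ → ℤˣ} (hc' : ∀ z ∈ tri N, c' z = c z) {k : ℕ}
      (hk : ∀ j < k, (step^[j + 1] (start c).rev).pos ∈ tri N) :
      step^[k] (start c').rev = (step^[k] (start c).rev).twist (c * c') := by
    rw [tw c', rev_twist]; exact iterate_step_twist fun j hj => twB hc' _ (hk j hj)
  by_cases hf : ∀ j, (step^[j] (start c)).pos ∈ tri N
  · refine ⟨∅, 1, by simp, by simp, fun c' hc' _ => (start_onBond c').exists_period (B := tri N) fun j => ?_⟩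
    rw [twi hc' fun j _ => hf _]; exact hf j
  by_cases hr : ∀ j, (step^[j] (start c).rev).pos ∈ tri N
  · refine ⟨∅, 1, by simp, by simp, fun c' hc' _ => exists_period_of_rev
      ((rev_start_onBond c').exists_period (B := tri N) fun j => ?_)⟩
    rw [twi' hc' fun j _ => hr _]; exact hr j
  obtain ⟨k, hk, hek, i, hi, hiN, hx⟩ := exists_exit (start_onBond c) h0 hf
  obtain ⟨k', hk', -, i', hi', hiN', hx'⟩ := exists_exit (rev_start_onBond c) h0' hr
  -- The first bond ends at `(1, 0)`, which lies in the triangle because `1 ≤ N`.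
  have hk0 : 0 < k := by
    rcases Nat.eq_zero_or_pos k with rfl | h
    · exact absurd h0' hek
    · exact h
  have hb := ((start_onBond c).iterate_step k).with_cfg
  have hb' := ((rev_start_onBond c).iterate_step k').with_cfg
  by_cases hsame : (step^[k] (start c)).pos = (step^[k'] (start c).rev).pos ∧
      (step^[k] (start c)).vel = (step^[k'] (start c).rev).vel
  · obtain ⟨D, hD, -⟩ := exists_sidePattern_left hb hi
    have hm := hD.mem hb.1 hx hi hiN
    obtain ⟨o, ho⟩ := hD.reflects
    refine ⟨D, o, hm, hD.card.trans (by norm_num), fun c' hc' hco => ?_⟩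
    refine exists_period_of_reflects_same (k := k) (k' := k') (B := tri N) (D := D) (o := o) hk0
      ?_ ?_ ?_ ?_ ?_ (fun z hz h => (hm z h).2.1 hz) hco
    · intro j hj; rw [twi hc' fun l hl => hk l (by omega)]; exact hk j hj
    · intro j hj; rw [twi' hc' fun l hl => hk' l (by omega)]; exact hk' j hj
    · rw [twi hc' hk]; exact ho
    · rw [twi hc' hk, twi' hc' hk']; exact hsame.1.symm
    · rw [twi hc' hk, twi' hc' hk']; exact hsame.2.symm
  · obtain ⟨D, D', hD, hD', hDD⟩ :=
      exists_disjoint_sidePattern hb hb' hx hx' hi hiN hi' hiN' hsame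
    have hm := hD.mem hb.1 hx hi hiN
    have hm' := hD'.mem hb'.1 hx' hi' hiN'
    obtain ⟨o, ho⟩ := hD.reflects
    obtain ⟨o', ho'⟩ := hD'.reflects
    classical
    refine ⟨D ∪ D', fun z => if z ∈ D then o z else o' z, fun z hz => ?_, ?_, fun c' hc' hco => ?_⟩
    · exact (Finset.mem_union.1 hz).elim (hm z) (hm' z)
    · have := Finset.card_union_le D D'
      have := hD.card
      have := hD'.card
      omega
    have hco1 : ∀ z ∈ D, c' z = o z := fun z hz => by
      simpa [hz] using hco z (Finset.mem_union_left _ hz)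
    have hco2 : ∀ z ∈ D', c' z = o' z := fun z hz => by
      simpa [Finset.disjoint_right.1 hDD hz] using hco z (Finset.mem_union_right _ hz)
    refine exists_period_of_reflects (k := k) (k' := k') (B := tri N) hk0
      ?_ ?_ ?_ ?_ (fun z hz h => (hm z h).2.1 hz) (fun z hz h => (hm' z h).2.1 hz) hDD hco1 hco2
    · intro j hj; rw [twi hc' fun l hl => hk l (by omega)]; exact hk j hj
    · intro j hj; rw [twi' hc' fun l hl => hk' l (by omega)]; exact hk' j hj
    · rw [twi hc' hk]; exact ho
    · rw [twi' hc' hk']; exact ho'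

/-! ### The dynamics in Cartesian and in triangular coordinates -/

theorem latticePoint_injective {a b c d : ℤ} (h : latticePoint a b = latticePoint c d) :
    a = c ∧ b = d := by
  have h0 := congrFun h 0
  have h1 := congrFun h 1
  simp only [latticePoint, Matrix.cons_val_zero, Matrix.cons_val_one] at h0 h1
  have hbd : b = d := by
    have : (0 : ℝ) < √3 / 2 := by positivity
    exact_mod_cast mul_right_cancel₀ this.ne' h1
  subst hbd
  exact ⟨by exact_mod_cast add_right_cancel h0, rfl⟩

theorem latticePoint_mem_honeycomb {z : ℤ × ℤ} (hz : (z.1 - z.2) % 3 ≠ 2) :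
    latticePoint z.1 z.2 ∈ honeycomb := ⟨z.1, z.2, hz, rfl⟩

/-- The configuration in triangular coordinates. -/
noncomputable def Config.toLattice (C : Config) (z : ℤ × ℤ) : ℤˣ :=
  C.orientationAt (latticePoint z.1 z.2)

theorem Config.toLattice_of_mem (C : Config) {z : ℤ × ℤ} (hz : (z.1 - z.2) % 3 ≠ 2) :
    C.toLattice z = C ⟨_, latticePoint_mem_honeycomb hz⟩ := by
  rw [toLattice, orientationAt, dif_pos (latticePoint_mem_honeycomb hz)]

theorem Config.toLattice_flip (C : Config) {z : ℤ × ℤ} (hz : (z.1 - z.2) % 3 ≠ 2) :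
    (C.flip (latticePoint z.1 z.2)).toLattice = Function.update C.toLattice z (-C.toLattice z) := by
  funext w
  by_cases hw : w = z
  · subst hw
    rw [Function.update_self, toLattice_of_mem _ hz, toLattice_of_mem _ hz, flip, if_pos rfl]
  · have hne : latticePoint w.1 w.2 ≠ latticePoint z.1 z.2 := fun h =>
      hw (Prod.ext (latticePoint_injective h).1 (latticePoint_injective h).2)
    rw [Function.update_of_ne hw, toLattice, toLattice, orientationAt, orientationAt]
    split_ifs with h
    · simp [flip, hne]
    · rfl

/-- `OnBond` ensures that the site entered is on the honeycomb lattice, where both models flip the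
same scatterer. -/
theorem stateAt_eq (C : Config) (t : ℕ) :
    (stateAt C t).pos = latticePoint (step^[t] (start C.toLattice)).pos.1
        (step^[t] (start C.toLattice)).pos.2 ∧
      (stateAt C t).vel = latticePoint (step^[t] (start C.toLattice)).vel.1
        (step^[t] (start C.toLattice)).vel.2 ∧
      (stateAt C t).config.toLattice = (step^[t] (start C.toLattice)).cfg := by
  induction t with
  | zero =>
    refine ⟨?_, ?_, rfl⟩ <;> ext i <;> fin_cases i <;> simp [stateAt, start, latticePoint]
  | succ t ih =>
    have hs : stateAt C (t + 1) = (stateAt C t).next := Function.iterate_succ_apply' _ _ _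
    obtain ⟨hp, hv, hc⟩ := ih
    have hb := (start_onBond C.toLattice).iterate_step t
    rw [hs, Function.iterate_succ_apply']
    generalize step^[t] (start C.toLattice) = s at *
    have hy : (stateAt C t).pos + (stateAt C t).vel =
        latticePoint (s.pos + s.vel).1 (s.pos + s.vel).2 := by
      rw [hp, hv, latticePoint_add]; rfl
    have hm : ((s.pos + s.vel).1 - (s.pos + s.vel).2) % 3 ≠ 2 := by
      have := hb.with_cfg.site
      omega
    refine ⟨hy, ?_, ?_⟩
    · simp only [State.next, hy, step, ← hc, turn]
      rw [hv, rotation_mulVec_latticePoint, Config.toLattice]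
      split_ifs <;> rfl
    · simp only [State.next, hy, step, Config.toLattice_flip _ hm, hc]

theorem hasPeriodicTrajectory_of_period {C : Config} {T : ℕ} (hT : 0 < T)
    (h : step^[T] (start C.toLattice) = start C.toLattice) : HasPeriodicTrajectory C := by
  refine ⟨T, hT, fun t => ?_⟩
  rw [position, position, (stateAt_eq C t).1, (stateAt_eq C (t + T)).1,
    Function.iterate_add_apply, h]

/-! ### Almost sure success of successive trials -/

instance measurableSingletonClass_units_int : MeasurableSingletonClass ℤˣ :=
  ⟨fun u => ⟨{(u : ℤ)}, measurableSet_singleton _, by ext; simp [Units.ext_iff]⟩⟩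

theorem prob_forall_eq_ge {ι Ω : Type*} [MeasurableSpace Ω] {P : Measure Ω}
    [IsProbabilityMeasure P] {Y : ι → Ω → ℤˣ} (hi : iIndepFun Y P) {ε : ENNReal}
    (hε : ε ≤ 1) (hY : ∀ i u, ε ≤ P (Y i ⁻¹' {u})) (D : Finset ι) (o : ι → ℤˣ) {m : ℕ}
    (hD : D.card ≤ m) : ε ^ m ≤ P {ω | ∀ i ∈ D, Y i ω = o i} := by
  have h := hi.measure_inter_preimage_eq_mul D (sets := fun i => {o i})
    (fun i _ => measurableSet_singleton _)
  have hset : {ω | ∀ i ∈ D, Y i ω = o i} = ⋂ i ∈ D, Y i ⁻¹' {o i} := by ext; simp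
  rw [hset, h]
  calc ε ^ m ≤ ε ^ D.card := pow_le_pow_right_of_le_one' hε hD
    _ = ∏ _i ∈ D, ε := by simp
    _ ≤ _ := Finset.prod_le_prod' fun i _ => hY i _

/-- If at every stage `n`, whatever the values on the finite set `S n`, finitely many prescribed
values on `S (n + 1) \ S n` force an event, then this event occurs almost surely. -/
theorem ae_of_forall_exists_pattern {ι Ω : Type*} [MeasurableSpace Ω] {P : Measure Ω}
    [IsProbabilityMeasure P] {Y : ι → Ω → ℤˣ} (hm : ∀ i, Measurable (Y i)) (hi : iIndepFun Y P)
    {ε : ENNReal} (hε0 : ε ≠ 0) (hε : ε ≤ 1) (hY : ∀ i u, ε ≤ P (Y i ⁻¹' {u}))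
    (S : ℕ → Finset ι) (hS : Monotone S) (m : ℕ) (A : Set (ι → ℤˣ))
    (h : ∀ n (c : ι → ℤˣ), ∃ (D : Finset ι) (o : ι → ℤˣ), (∀ i ∈ D, i ∉ S n ∧ i ∈ S (n + 1)) ∧
      D.card ≤ m ∧ ∀ c', (∀ i ∈ S n, c' i = c i) → (∀ i ∈ D, c' i = o i) → c' ∈ A) :
    ∀ᵐ ω ∂P, (fun i => Y i ω) ∈ A := by
  classical
  choose D o hD hcard hA using h
  let res (n : ℕ) (c : ι → ℤˣ) : S n → ℤˣ := fun i => c i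
  -- The pattern of stage `n` is chosen for the extension by `1` of the values on `S n`, so that it
  -- depends on these finitely many values only.
  let ext (n : ℕ) (r : S n → ℤˣ) : ι → ℤˣ := fun i => if hi : i ∈ S n then r ⟨i, hi⟩ else 1
  have ext_res (n c) (i) (hi : i ∈ S n) : c i = ext n (res n c) i := by simp [ext, res, hi]
  let good (n : ℕ) (r : S n → ℤˣ) : Set (ι → ℤˣ) :=
    {c | ∀ i ∈ D n (ext n r), c i = o n (ext n r) i}
  let G (M : ℕ) : Set (ι → ℤˣ) := {c | ∀ n < M, c ∉ good n (res n c)}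
  have hGA (M : ℕ) : Aᶜ ⊆ G M := fun c hc n _ hgood =>
    hc (hA n _ c (ext_res n c) hgood)
  have hGdep (M : ℕ) (c c' : ι → ℤˣ) (hcc : ∀ i ∈ S M, c i = c' i) (hc : c ∈ G M) : c' ∈ G M := by
    intro n hn hgood
    have hr : res n c = res n c' := funext fun i => hcc i (hS hn.le i.2)
    refine hc n hn fun i hiD => ?_
    rw [hr] at hiD ⊢
    rw [hcc i (hS (by omega : n + 1 ≤ M) (hD _ _ i hiD).2)]
    exact hgood i hiD
  let Z (ω : Ω) : ι → ℤˣ := fun i => Y i ω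
  have hres (M : ℕ) : Measurable fun ω => res M (Z ω) := measurable_pi_lambda _ fun i => hm i
  -- Failure before stage `M` is determined by the values `r` on `S M`. For each `r`, the next
  -- pattern lies off `S M` and is therefore independent of them.
  have hstep (M : ℕ) : P (Z ⁻¹' G (M + 1)) ≤ P (Z ⁻¹' G M) * (1 - ε ^ m) := by
    let R : Finset (S M → ℤˣ) := {r | ext M r ∈ G M}
    have hsub : Z ⁻¹' G (M + 1) ⊆
        ⋃ r ∈ R, (fun ω => res M (Z ω)) ⁻¹' {r} ∩ (Z ⁻¹' good M r)ᶜ := by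
      intro ω hω
      refine Set.mem_biUnion (x := res M (Z ω)) ?_ ⟨rfl, hω M (by omega)⟩
      simp only [R, Finset.coe_filter, Finset.mem_univ, true_and, Set.mem_ofPred_eq]
      exact hGdep M (Z ω) _ (ext_res M (Z ω)) fun n hn => hω n (by omega)
    have hpre : Z ⁻¹' G M = (fun ω => res M (Z ω)) ⁻¹' (R : Set (S M → ℤˣ)) := by
      ext ω
      simp only [R, Finset.coe_filter, Finset.mem_univ, true_and, Set.mem_ofPred_eq,
        Set.mem_preimage]
      exact ⟨hGdep M _ _ (ext_res M _), hGdep M _ _ fun i hi => (ext_res M (Z ω) i hi).symm⟩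
    have hterm (r : S M → ℤˣ) : P ((fun ω => res M (Z ω)) ⁻¹' {r} ∩ (Z ⁻¹' good M r)ᶜ) ≤
        P ((fun ω => res M (Z ω)) ⁻¹' {r}) * (1 - ε ^ m) := by
      set E := D M (ext M r) with hE
      have hdisj : Disjoint (S M) E :=
        Finset.disjoint_right.2 fun i hi => (hD _ _ i hi).1
      have hind := hi.indepFun_finset (S M) E hdisj hm
      have hgood : Z ⁻¹' good M r =
          (fun ω (i : E) => Y i ω) ⁻¹' {fun i : E => o M (ext M r) i} := by
        ext ω
        simp only [good, Z, Set.mem_preimage, Set.mem_ofPred_eq, Set.mem_singleton_iff,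
          funext_iff, Subtype.forall, hE]
      have hmeas : MeasurableSet (Z ⁻¹' good M r) := by
        rw [hgood]
        have hm' : Measurable fun ω (i : E) => Y i ω := measurable_pi_lambda _ fun i => hm i
        exact hm' (measurableSet_singleton _)
      have h1 := hind.measure_inter_preimage_eq_mul {r} {fun i : E => o M (ext M r) i}ᶜ
        (measurableSet_singleton _) (measurableSet_singleton _).compl
      rw [Set.preimage_compl, ← hgood] at h1
      refine (h1.trans_le ?_)
      gcongr
      · rw [prob_compl_eq_one_sub hmeas]
        exact tsub_le_tsub_left (prob_forall_eq_ge hi hε hY _ _ (hcard _ _)) 1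
    calc P (Z ⁻¹' G (M + 1)) ≤ _ := measure_mono hsub
      _ ≤ ∑ r ∈ R, P ((fun ω => res M (Z ω)) ⁻¹' {r} ∩ (Z ⁻¹' good M r)ᶜ) :=
        measure_biUnion_finset_le _ _
      _ ≤ ∑ r ∈ R, P ((fun ω => res M (Z ω)) ⁻¹' {r}) * (1 - ε ^ m) :=
        Finset.sum_le_sum fun r _ => hterm r
      _ = _ := by
        rw [← Finset.sum_mul, sum_measure_preimage_singleton, hpre]
        exact fun r _ => hres M (measurableSet_singleton r)
  have hpow (M : ℕ) : P (Z ⁻¹' G M) ≤ (1 - ε ^ m) ^ M := by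
    induction M with
    | zero => simpa using prob_le_one
    | succ M ih => exact (hstep M).trans (by rw [pow_succ]; gcongr)
  have hlt : 1 - ε ^ m < 1 := ENNReal.sub_lt_self (by simp) (by simp) (pow_ne_zero _ hε0)
  have hle : P (Z ⁻¹' Aᶜ) ≤ 0 :=
    ge_of_tendsto' (ENNReal.tendsto_pow_atTop_nhds_zero_of_lt_one hlt) fun M =>
      (measure_mono (Set.preimage_mono (hGA M))).trans (hpow M)
  exact nonpos_iff_eq_zero.1 hle

/-! ### Transfer to the random honeycomb configuration -/

/-- The sites of the honeycomb lattice in triangular coordinates. -/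
abbrev Site : Type := {z : ℤ × ℤ // (z.1 - z.2) % 3 ≠ 2}

/-- The site of the honeycomb lattice with given triangular coordinates. -/
noncomputable def Site.toHoneycomb (z : Site) : honeycomb := ⟨_, latticePoint_mem_honeycomb z.2⟩

theorem Site.toHoneycomb_injective : Function.Injective Site.toHoneycomb := fun z w h => by
  have := latticePoint_injective (congrArg Subtype.val h)
  exact Subtype.ext (Prod.ext this.1 this.2)

/-- Orientations at the sites, extended by `1` to the triangular lattice. -/
def extendSite (c : Site → ℤˣ) (z : ℤ × ℤ) : ℤˣ := if h : (z.1 - z.2) % 3 ≠ 2 then c ⟨z, h⟩ else 1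

theorem toLattice_eq_extendSite (C : Config) :
    C.toLattice = extendSite fun z => C z.toHoneycomb := by
  funext z
  by_cases hz : (z.1 - z.2) % 3 ≠ 2
  · rw [extendSite, dif_pos hz, Config.toLattice_of_mem C hz]; rfl
  · rw [extendSite, dif_neg hz, Config.toLattice, Config.orientationAt, dif_neg]
    rintro ⟨a, b, hab, h⟩
    obtain ⟨rfl, rfl⟩ := latticePoint_injective h
    exact hz hab

theorem exists_site_pattern {N : ℤ} (hN : 1 ≤ N) (c : Site → ℤˣ) :
    ∃ (D : Finset Site) (o : Site → ℤˣ), (∀ z ∈ D, z.1 ∉ tri N ∧ z.1 ∈ tri (N + 20)) ∧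
      D.card ≤ 40 ∧ ∀ c' : Site → ℤˣ, (∀ z : Site, z.1 ∈ tri N → c' z = c z) →
        (∀ z ∈ D, c' z = o z) →
        ∃ T, 0 < T ∧ LState.step^[T] (start (extendSite c')) = start (extendSite c') := by
  obtain ⟨D, o, hD, hcard, h⟩ := exists_pattern hN (extendSite c)
  refine ⟨D.subtype _, fun z => o z, fun z hz => (hD z (Finset.mem_subtype.1 hz)).2, ?_,
    fun c' hc' hco => h _ (fun z hz => ?_) fun z hz => ?_⟩
  · rw [Finset.card_subtype]
    exact (Finset.card_filter_le _ _).trans hcard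
  · by_cases hs : (z.1 - z.2) % 3 ≠ 2
    · rw [extendSite, extendSite, dif_pos hs, dif_pos hs, hc' _ hz]
    · rw [extendSite, extendSite, dif_neg hs, dif_neg hs]
  · have hs := (hD z hz).1
    rw [extendSite, dif_pos hs]
    exact hco ⟨z, hs⟩ (Finset.mem_subtype.2 hz)

/-- Both orientations have probability at least some `ε > 0`, uniformly in the site. -/
theorem IsInitialConfiguration.exists_prob_ge {Ω : Type*} [MeasurableSpace Ω] {P : Measure Ω}
    [IsProbabilityMeasure P] {n : ℕ} {f : Fin n → Set.Icc (0 : ℝ) 1 → Set.Icc (0 : ℝ) 1}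
    {p : Set.Icc (0 : ℝ) 1} (hf : ∀ i, f i p ≠ 0 ∧ f i p ≠ 1)
    {C : honeycomb → Ω → Orientation} (hC : IsInitialConfiguration P f p C) :
    ∃ ε : ENNReal, ε ≠ 0 ∧ ε ≤ 1 ∧ ∀ h u, ε ≤ P (C h ⁻¹' {u}) := by
  let q (i : Fin n) : ℝ := min (f i p) (1 - f i p)
  have hq (i : Fin n) : 0 < q i := by
    have h0 : (f i p : ℝ) ≠ 0 := fun h => (hf i).1 (Subtype.ext h)
    have h1 : (f i p : ℝ) ≠ 1 := fun h => (hf i).2 (Subtype.ext h)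
    exact lt_min (lt_of_le_of_ne (f i p).2.1 h0.symm)
      (sub_pos.2 (lt_of_le_of_ne (f i p).2.2 h1))
  have hε : ∃ ε : ℝ, 0 < ε ∧ ε ≤ 1 ∧ ∀ i, ε ≤ q i := by
    rcases isEmpty_or_nonempty (Fin n) with h | h
    · exact ⟨1, one_pos, le_rfl, fun i => h.elim i⟩
    · obtain ⟨i₀, hi₀⟩ := Finite.exists_min q
      exact ⟨q i₀, hq i₀, (min_le_left _ _).trans (f i₀ p).2.2, hi₀⟩
  obtain ⟨ε, hε0, hε1, hεq⟩ := hε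
  refine ⟨ENNReal.ofReal ε, by simpa using hε0, ENNReal.ofReal_le_one.2 hε1, fun h u => ?_⟩
  rw [← ofReal_measureReal]
  apply ENNReal.ofReal_le_ofReal
  obtain ⟨i, hi⟩ := hC.prob_right h
  have hi' : P.real (C h ⁻¹' {1}) = f i p := hi
  rcases Int.units_eq_one_or u with rfl | rfl
  · rw [hi']; exact (hεq i).trans (min_le_left _ _)
  · have hc : C h ⁻¹' {-1} = (C h ⁻¹' {1})ᶜ := by
      ext ω
      rcases Int.units_eq_one_or (C h ω) with h1 | h1 <;> simp [h1]
    rw [hc, probReal_compl_eq_one_sub (hC.measurable h (measurableSet_singleton _)), hi']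
    exact (hεq i).trans (min_le_right _ _)

end FlippingRotator

theorem mainTheorem3 {Ω : Type*} [MeasurableSpace Ω] (P : MeasureTheory.Measure Ω)
    [MeasureTheory.IsProbabilityMeasure P] {n : ℕ}
    (f : Fin n → Set.Icc (0 : ℝ) 1 → Set.Icc (0 : ℝ) 1) (p : Set.Icc (0 : ℝ) 1)
    (hf : ∀ i, f i p ≠ 0 ∧ f i p ≠ 1)
    (C : FlippingRotator.honeycomb → Ω → FlippingRotator.Orientation)
    (hC : FlippingRotator.IsInitialConfiguration P f p C) :
    ∀ᵐ ω ∂P, FlippingRotator.HasPeriodicTrajectory (fun h => C h ω) := by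
  open FlippingRotator in
  obtain ⟨ε, hε0, hε1, hε⟩ := hC.exists_prob_ge hf
  have key := ae_of_forall_exists_pattern (P := P) (Y := fun z : Site => C z.toHoneycomb)
    (fun z => hC.measurable _) (hC.indep.precomp Site.toHoneycomb_injective) hε0 hε1
    -- Each stage adds the 20 layers that contain the mirrors; the `+ 1` provides `1 ≤ N` at stage
    -- zero.
    (fun z u => hε _ u) (fun k => (tri (20 * k + 1)).subtype _)
    (fun k l hkl z hz => by
      rw [Finset.mem_subtype, mem_tri] at hz ⊢
      have : (k : ℤ) ≤ l := by exact_mod_cast hkl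
      omega)
    40 {c | ∃ T, 0 < T ∧ LState.step^[T] (start (extendSite c)) = start (extendSite c)}
    (fun k c => by
      obtain ⟨D, o, hD, hcard, h⟩ := exists_site_pattern (N := 20 * k + 1) (by omega) c
      refine ⟨D, o, fun z hz => ?_, hcard, fun c' hc' hco =>
        h c' (fun z hz => hc' z (Finset.mem_subtype.2 hz)) hco⟩
      rw [Finset.mem_subtype, Finset.mem_subtype]
      refine ⟨(hD z hz).1, ?_⟩
      have : (20 * ((k + 1 : ℕ) : ℤ) + 1) = 20 * k + 1 + 20 := by push_cast; ring
      rw [this]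
      exact (hD z hz).2)
  filter_upwards [key] with ω ⟨T, hT, h⟩
  refine hasPeriodicTrajectory_of_period hT ?_
  rwa [toLattice_eq_extendSite]
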